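/- **Corollary 2.3** (Yan–Zhang). Let $G$ be a finite simple plane graph (a graph drawn in the plane without crossings) which is bipartite with colour classes $U$ and $V$, $|U|=|V|=n$, and whose edges carry weights in a commutative semiring (for instance real numbers, or indeterminates; all weights equal to $1$ gives plain counting). For a set $S$ of vertices let $G-S$ be the graph obtained by deleting the vertices of $S$ and their incident edges, and let $M(H)$ denote the sum, over all perfect matchings of a weighted graph $H$, of the product of the weights of the edges of the matching (so $M(H)=1$ if $H$ has no vertices). Let the vertices $a_1,b_1,a_2,b_2,\dots,a_k,b_k$ appear in this cyclic order on a face $F$ of $G$: that is, there is a closed topological disc which is contained in $F$ except that its boundary circle passes through these $2k$ distinct vertices, in this cyclic order. Suppose that $A=\{a_1,\dots,a_k\}\subseteq U$ and $B=\{b_1,\dots,b_k\}\subseteq V$. Then for every $j\in\{1,\dots,k\}$, $$M(G)\,M(G-(A\cup B))=\sum_{i=1}^{k} M(G-\{a_j,b_i\})\;M\bigl(G-((A\cup B)\setminus\{a_j,b_i\})\bigr).$$ -/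

import Mathlib

/-- A plane graph: a drawing of the simple graph `G` in the Euclidean plane (the complex plane).
Vertices are distinct points, every edge is a simple arc joining the points of its two ends, the
interior of an edge contains no vertex, and two distinct edges meet at most in vertices. -/
structure PlaneDrawing {W : Type*} (G : SimpleGraph W) where
  /-- the point representing a vertex -/
  pos : W → ℂ
  pos_injective : Function.Injective pos
  /-- a parametrization of the arc representing an edge -/
  curve : G.edgeSet → C(unitInterval, ℂ)
  curve_injective : ∀ e, Function.Injective (curve e)
  curve_ends : ∀ e, s(curve e 0, curve e 1) = Sym2.map pos (e : Sym2 W)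
  curve_interior : ∀ e t, t ∈ Set.Ioo (0 : unitInterval) 1 → curve e t ∉ Set.range pos
  curve_inter : ∀ e e' s t, e ≠ e' → curve e s = curve e' t → curve e s ∈ Set.range pos

namespace PlaneDrawing

variable {W : Type*} {G : SimpleGraph W}

/-- The set of all points of the plane that lie on a vertex or an edge. -/
def carrier (D : PlaneDrawing G) : Set ℂ :=
  Set.range D.pos ∪ ⋃ e, Set.range (D.curve e)

/-- A face is a connected component of the complement of the drawing. -/
def IsFace (D : PlaneDrawing G) (F : Set ℂ) : Prop :=
  ∃ z ∈ D.carrierᶜ, F = connectedComponentIn D.carrierᶜ z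

/-- The vertices `c 0, c 1, …, c (m - 1)` appear in this cyclic order on `F`: there is a closed
topological disc (an embedded copy, under `h`, of the closed unit disc) which is contained in `F`
except that its boundary circle passes through these vertices, in this cyclic order. The disc lies
in the face, so the whole graph is on the other side of its boundary circle. When the boundary of
the face is a single closed walk, this says that the walk meets the vertices in this cyclic order,
in one of its two directions; it makes sense also when the boundary is disconnected.
In particular the vertices are distinct. -/
def InCyclicOrderOn (D : PlaneDrawing G) (F : Set ℂ) {m : ℕ} (c : Fin m → W) : Prop :=
  ∃ (h : ℂ → ℂ) (θ : Fin m → ℝ),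
    ContinuousOn h (Metric.closedBall 0 1) ∧
    Set.InjOn h (Metric.closedBall 0 1) ∧
    StrictMono θ ∧
    (∀ i, θ i ∈ Set.Ico 0 (2 * Real.pi)) ∧
    (∀ i, h (Complex.exp (θ i * Complex.I)) = D.pos (c i)) ∧
    ∀ z ∈ Metric.closedBall (0 : ℂ) 1,
      (∀ i, z ≠ Complex.exp (θ i * Complex.I)) → h z ∈ F

end PlaneDrawing

/-- The sequence `a 0, b 0, a 1, b 1, …, a (k - 1), b (k - 1)`. -/
def interleave {W : Type*} {k : ℕ} (a b : Fin k → W) : Fin (2 * k) → W := fun i =>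
  if (i : ℕ) % 2 = 0 then a ⟨(i : ℕ) / 2, by omega⟩ else b ⟨(i : ℕ) / 2, by omega⟩

/-- `M(G)`: the sum, over the perfect matchings of the finite graph `G`, of the product of the
weights of the edges of the matching. Only the values of `w` on edges of `G` matter. -/
noncomputable def matchingSum {R : Type*} [CommSemiring R] {W : Type*} [Finite W]
    (G : SimpleGraph W) (w : Sym2 W → R) : R :=
  ∑ᶠ P : {P : G.Subgraph // P.IsPerfectMatching}, ∏ᶠ e : P.1.edgeSet, w e

/-- `M(G - S)`: the sum of weights of perfect matchings of the graph obtained from `G` by deleting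
the vertices in `S` and their incident edges; the other edges keep their weights. -/
noncomputable def matchingSumDelete {R : Type*} [CommSemiring R] {W : Type*} [Finite W]
    (G : SimpleGraph W) (w : Sym2 W → R) (S : Set W) : R :=
  matchingSum (G.induce Sᶜ) (fun e => w (Sym2.map Subtype.val e))

/-! Superpose a perfect matching of `G` with one of `G - (A ∪ B)`. The vertices of `A ∪ B` have
degree one and all others degree two (a doubled edge counting twice), so the component of `a j` is a
path. It begins and ends with edges of the first matching, so its length is odd and, by colour, its
other end is some `b i`. Exchanging the two matchings along this path transfers the deletion of `a
j` and `b i` from the second matching to the first, keeps the product of the weights, and is undone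
by the same exchange (`swapOnOrbit_involutive`).

For a pair counted on the right, colour alone would also allow the path from `a j` to end at some `a
l`. Planarity excludes this: components are connected and pairwise disjoint, hence do not cross, so
the ends lying strictly between the two ends of a path are paired among themselves and are even in
number; between two members of `A` there is an odd number (`odd_add_of_mem_jointOrbit`). So the path
ends at `b i`, and the exchange is a bijection. Matchings are encoded as involutions fixing exactly
the deleted vertices, and components as joint orbits.

Noncrossing (`InCyclicOrderOn.not_disjoint`) rests on `not_joinedIn_of_separated_in_disc`. Suppose
`K₁` contains the images of both ends of a chord of the disc and a path in the disjoint set `K₂`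
joins the two sides. For `p`, `q` in the image of the disc on either side, neither `K₁` with the
chord nor `K₁` with an arc of the circle separates `p` from `q`, so `(z - p) / (z - q)` has a
continuous logarithm on each. Since `K₁` is connected the logarithms glue on the boundary of the
half disc around `p`, which contradicts its winding around `p`. -/

open Set Complex Metric

/-! ### Continuous logarithms and winding of embedded circles. -/

/-- The function `f` has a continuous logarithm on `s`. -/
def HasLogOn {X : Type*} [TopologicalSpace X] (f : X → ℂ) (s : Set X) : Prop :=
  ∃ g : X → ℂ, ContinuousOn g s ∧ ∀ x ∈ s, exp (g x) = f x

namespace HasLogOn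

variable {X Y : Type*} [TopologicalSpace X] [TopologicalSpace Y] {f g : X → ℂ} {s t : Set X}

theorem mono (h : HasLogOn f t) (hst : s ⊆ t) : HasLogOn f s :=
  let ⟨l, hl, hf⟩ := h
  ⟨l, hl.mono hst, fun x hx => hf x (hst hx)⟩

theorem congr (h : HasLogOn f s) (hfg : EqOn f g s) : HasLogOn g s :=
  let ⟨l, hl, hf⟩ := h
  ⟨l, hl, fun x hx => (hf x hx).trans (hfg hx)⟩

theorem const {c : ℂ} (hc : c ≠ 0) : HasLogOn (fun _ : X => c) s :=
  ⟨fun _ => log c, continuousOn_const, fun _ _ => exp_log hc⟩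

theorem mul (hf : HasLogOn f s) (hg : HasLogOn g s) : HasLogOn (fun x => f x * g x) s :=
  let ⟨k, hk, hkf⟩ := hf
  let ⟨l, hl, hlg⟩ := hg
  ⟨fun x => k x + l x, hk.add hl, fun x hx => by rw [exp_add, hkf x hx, hlg x hx]⟩

theorem comp (hf : HasLogOn f s) {u : Y → X} {r : Set Y} (hu : ContinuousOn u r)
    (hm : MapsTo u r s) : HasLogOn (f ∘ u) r :=
  let ⟨l, hl, hlf⟩ := hf
  ⟨l ∘ u, hl.comp hu hm, fun _ hy => hlf _ (hm hy)⟩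

/-- Having a continuous logarithm is invariant under homotopies through nonvanishing functions. -/
theorem of_homotopy (H : ℝ → X → ℂ)
    (hH : ContinuousOn (fun p : ℝ × X => H p.1 p.2) (Icc 0 1 ×ˢ s))
    (hne : ∀ t ∈ Icc (0 : ℝ) 1, ∀ x ∈ s, H t x ≠ 0) (h0 : HasLogOn (H 0) s) :
    HasLogOn (H 1) s := by
  classical
  obtain ⟨l, hl, hlH⟩ := h0
  let F : C(unitInterval × s, {z : ℂ // z ≠ 0}) :=
    ⟨fun p => ⟨H p.1 p.2, hne _ p.1.2 _ p.2.2⟩, by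
      refine Continuous.subtype_mk ?_ _
      exact hH.comp_continuous (f := fun p : unitInterval × s => ((p.1 : ℝ), (p.2 : X)))
        (by fun_prop) (fun p => ⟨p.1.2, p.2.2⟩)⟩
  let l' : C(s, ℂ) := ⟨fun x => l x, continuousOn_iff_continuous_domRestrict.mp hl⟩
  have hF : ∀ x, F (0, x) = ⟨exp (l' x), exp_ne_zero _⟩ := fun x =>
    Subtype.ext (hlH x x.2).symm
  have hlift := isCoveringMap_exp.liftHomotopy_lifts F l' hF
  refine ⟨fun x => if hx : x ∈ s then isCoveringMap_exp.liftHomotopy F l' hF (1, ⟨x, hx⟩) else 0,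
    ?_, fun x hx => ?_⟩
  · rw [continuousOn_iff_continuous_domRestrict]
    have : Continuous fun x : s => isCoveringMap_exp.liftHomotopy F l' hF (1, x) := by fun_prop
    convert this using 2 with x
    simp [Set.domRestrict]
  · have := congrArg Subtype.val (congrFun hlift (1, ⟨x, hx⟩))
    simpa [hx, F] using this

/-- A nonvanishing continuous function on a convex set has a continuous logarithm. -/
theorem of_convex {E : Type*} [NormedAddCommGroup E] [NormedSpace ℝ E] {f : E → ℂ} {s : Set E}
    (hs : Convex ℝ s) (hf : ContinuousOn f s) (hne : ∀ x ∈ s, f x ≠ 0) : HasLogOn f s := by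
  rcases s.eq_empty_or_nonempty with rfl | ⟨c, hc⟩
  · exact ⟨0, continuousOn_empty _, by simp⟩
  have hmem : ∀ t ∈ Icc (0 : ℝ) 1, ∀ x ∈ s, (1 - t) • c + t • x ∈ s := fun t ht x hx =>
    hs hc hx (by linarith [ht.2]) ht.1 (by ring)
  -- Contracting the set to `c` deforms `f` from the constant `f c`.
  refine (of_homotopy (fun t x => f ((1 - t) • c + t • x)) ?_
    (fun t ht x hx => hne _ (hmem t ht x hx)) ?_).congr fun x _ => by simp
  · exact hf.comp (f := fun p : ℝ × E => (1 - p.1) • c + p.1 • p.2)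
      (by fun_prop) (fun p hp => hmem _ hp.1 _ hp.2)
  · exact (const (hne c hc)).congr fun x _ => by simp

/-- If `p` and `q` are joined in the complement of `s`, then `(z - p) / (z - q)` has a continuous
logarithm on `s`. -/
theorem of_joinedIn {s : Set ℂ} {p q : ℂ} (h : JoinedIn sᶜ p q) :
    HasLogOn (fun z => (z - p) / (z - q)) s := by
  -- The path is reversed so that the homotopy starts at `(z - q) / (z - q) = 1`.
  obtain ⟨γ, hγ⟩ := h.symm
  have hmem : ∀ t, ∀ z ∈ s, z - γ.extend t ≠ 0 := fun t z hz h0 => by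
    have : γ.extend t ∈ range γ := by rw [← γ.extend_range]; exact mem_range_self t
    obtain ⟨u, hu⟩ := this
    exact hγ u (by rw [hu, ← sub_eq_zero.mp h0]; exact hz)
  have hq : ∀ z ∈ s, z - q ≠ 0 := fun z hz => by simpa using hmem 0 z hz
  refine (of_homotopy (fun t z => (z - γ.extend t) / (z - q)) ?_
    (fun t _ z hz => div_ne_zero (hmem t z hz) (hq z hz)) ?_).congr fun z _ => by simp
  · refine ContinuousOn.div ?_ ?_ fun p hp => hq _ hp.2
    · exact (continuous_snd.sub (γ.continuous_extend.comp continuous_fst)).continuousOn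
    · fun_prop
  · exact (const one_ne_zero).congr fun z hz => by simp [hq z hz]

end HasLogOn

/-- Two continuous logarithms of the same function on a connected set differ by a constant. -/
theorem IsPreconnected.sub_eq_sub_of_exp_eq {X : Type*} [TopologicalSpace X] {s : Set X}
    (hs : IsPreconnected s) {f g : X → ℂ} {c : ℂ} (hf : ContinuousOn f s) (hg : ContinuousOn g s)
    (h : ∀ x ∈ s, exp (f x) = c * exp (g x)) {x y : X} (hx : x ∈ s) (hy : y ∈ s) :
    f x - g x = f y - g y := by
  have hdisc : IsDiscrete (AddSubgroup.zmultiples (2 * Real.pi * I) : Set ℂ) :=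
    ⟨NormedSpace.discreteTopology_zmultiples _⟩
  obtain ⟨d, -, hd⟩ := hs.eqOn_const_of_mapsTo hdisc
    (f := fun z => (f z - g z) - (f x - g x)) (by fun_prop) (fun z hz => by
      have hc : ∀ z ∈ s, exp (f z - g z) = c := fun z hz => by
        rw [exp_sub, h z hz, mul_div_cancel_right₀ _ (exp_ne_zero _)]
      obtain ⟨n, hn⟩ := exp_eq_exp_iff_exists_int.mp ((hc z hz).trans (hc x hx).symm)
      exact AddSubgroup.mem_zmultiples_iff.mpr ⟨n, by simp only [hn, zsmul_eq_mul]; ring⟩)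
    ⟨0, zero_mem _⟩
  have h1 := hd hx
  have h2 := hd hy
  simp only [sub_self, Function.const_apply] at h1 h2
  rw [← h1] at h2
  exact (sub_eq_zero.mp h2).symm

/-- A nonvanishing odd function on the circle has no continuous logarithm. -/
theorem not_hasLogOn_sphere_of_odd {f : ℂ → ℂ} (hf : ∀ z ∈ sphere (0 : ℂ) 1, f (-z) = -f z) :
    ¬ HasLogOn f (sphere 0 1) := by
  rintro ⟨g, hg, hgf⟩
  have hneg : MapsTo (fun z : ℂ => -z) (sphere 0 1) (sphere 0 1) := fun z hz => by simpa using hz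
  have hpre : IsPreconnected (sphere (0 : ℂ) 1) :=
    (isConnected_sphere (by simp [Complex.rank_real_complex]) 0 zero_le_one).isPreconnected
  have h1 : (1 : ℂ) ∈ sphere (0 : ℂ) 1 := by simp
  -- The difference `g (-z) - g z` is constant on the circle, but changes sign between `1` and `-1`;
  -- so it is zero, contrary to oddness.
  have hc := hpre.sub_eq_sub_of_exp_eq (c := -1) (hg.comp continuousOn_neg hneg) hg
    (fun z hz => by rw [Function.comp_apply, hgf _ (hneg hz), hf z hz, hgf z hz]; ring) h1 (hneg h1)
  simp only [Function.comp_apply, neg_neg] at hc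
  have heq : g (-1) = g 1 := by linear_combination hc / 2
  have h2 := hgf _ (hneg h1)
  rw [heq, hf 1 h1, ← hgf 1 h1] at h2
  exact exp_ne_zero (g 1) (by linear_combination h2 / 2)

/-- The image of the unit circle under an embedding of the closed unit disc winds around the image
of the centre. -/
theorem not_hasLogOn_sphere_of_injOn {h : ℂ → ℂ} (hc : ContinuousOn h (closedBall 0 1))
    (hi : InjOn h (closedBall 0 1)) : ¬ HasLogOn (fun z => h z - h 0) (sphere 0 1) := by
  intro hlog
  have hn : ∀ t ∈ Icc (0 : ℝ) 1, ‖(1 + t : ℂ)‖ = 1 + t := fun t ht => by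
    rw [← ofReal_one, ← ofReal_add, norm_real, Real.norm_of_nonneg (by linarith [ht.1])]
  have hne : ∀ t ∈ Icc (0 : ℝ) 1, (1 + t : ℂ) ≠ 0 := fun t ht => by
    rw [← norm_ne_zero_iff, hn t ht]; linarith [ht.1]
  have hm₁ : ∀ t ∈ Icc (0 : ℝ) 1, ∀ z ∈ sphere (0 : ℂ) 1, z / (1 + t) ∈ closedBall (0 : ℂ) 1 :=
    fun t ht z hz => by
      rw [mem_closedBall_zero_iff, norm_div, hn t ht, mem_sphere_zero_iff_norm.mp hz]
      exact div_le_one_of_le₀ (by linarith [ht.1]) (by linarith [ht.1])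
  have hm₂ : ∀ t ∈ Icc (0 : ℝ) 1, ∀ z ∈ sphere (0 : ℂ) 1,
      -(t * z) / (1 + t) ∈ closedBall (0 : ℂ) 1 :=
    fun t ht z hz => by
      rw [mem_closedBall_zero_iff, norm_div, hn t ht, norm_neg, norm_mul,
        mem_sphere_zero_iff_norm.mp hz, norm_real, Real.norm_of_nonneg ht.1]
      exact div_le_one_of_le₀ (by linarith [ht.1]) (by linarith [ht.1])
  have hsph : ∀ z ∈ sphere (0 : ℂ) 1, z ≠ 0 := fun z hz h0 => by simp [h0] at hz
  refine not_hasLogOn_sphere_of_odd (f := fun z => h (z / 2) - h (-z / 2)) (fun z _ => by simp) ?_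
  -- The two arguments of `h` always differ by exactly `z ≠ 0`, so injectivity keeps the homotopy
  -- nonvanishing. It runs from `h z - h 0` to the odd function above.
  refine (HasLogOn.of_homotopy (fun (t : ℝ) z => h (z / (1 + t)) - h (-(t * z) / (1 + t))) ?_ ?_
    ?_).congr fun z _ => by norm_num
  · refine ContinuousOn.sub (hc.comp (f := fun p : ℝ × ℂ => p.2 / (1 + p.1)) ?_ ?_)
      (hc.comp (f := fun p : ℝ × ℂ => -(p.1 * p.2) / (1 + p.1)) ?_ ?_)
    · exact ContinuousOn.div (by fun_prop) (by fun_prop) fun p hp => hne _ hp.1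
    · exact fun p hp => hm₁ _ hp.1 _ hp.2
    · exact ContinuousOn.div (by fun_prop) (by fun_prop) fun p hp => hne _ hp.1
    · exact fun p hp => hm₂ _ hp.1 _ hp.2
  · intro t ht z hz h0
    have := hi (hm₁ t ht z hz) (hm₂ t ht z hz) (sub_eq_zero.mp h0)
    rw [div_left_inj' (hne t ht)] at this
    have h2 : (1 + t : ℂ) * z = 0 := by linear_combination this
    exact mul_ne_zero (hne t ht) (hsph z hz) h2
  · exact hlog.congr fun z _ => by simp

/-- The image of the boundary of a convex body in the plane under an embedding of that body winds
around some interior point. -/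
theorem exists_not_hasLogOn_frontier {h : ℂ → ℂ} {C : Set ℂ} (hC : Convex ℝ C)
    (hcl : IsClosed C) (hne : (interior C).Nonempty) (hb : Bornology.IsBounded C)
    (hc : ContinuousOn h C) (hi : InjOn h C) :
    ∃ c ∈ interior C, ¬ HasLogOn (fun z => h z - h c) (frontier C) := by
  obtain ⟨e, he₁, he₂, he₃⟩ :=
    exists_homeomorph_image_interior_closure_frontier_eq_unitBall hC hne hb
  rw [hcl.closure_eq] at he₂
  have hm : MapsTo e.symm (closedBall 0 1) C := by
    rw [← he₂]; rintro _ ⟨x, hx, rfl⟩; simpa using hx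
  have hf : MapsTo e.symm (sphere 0 1) (frontier C) := by
    rw [← he₃]; rintro _ ⟨x, hx, rfl⟩; simpa using hx
  refine ⟨e.symm 0, ?_, fun hlog => ?_⟩
  · have : (0 : ℂ) ∈ e '' interior C := by rw [he₁]; simp
    obtain ⟨x, hx, h0⟩ := this
    rw [← h0]; simpa using hx
  · exact not_hasLogOn_sphere_of_injOn (h := h ∘ e.symm)
      (hc.comp e.symm.continuous.continuousOn hm)
      (hi.comp e.symm.injective.injOn hm) (hlog.comp e.symm.continuous.continuousOn hf)

/-! ### Noncrossing of connected sets outside an embedded disc. -/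

/-- Two disjoint connected sets outside an embedded disc cannot join two pairs of points of the
boundary circle that separate each other. The line `L z = r` separates `a` from `b`, and meets the
unit circle only in points whose images are in the first set. -/
theorem not_joinedIn_of_separated_in_disc {h : ℂ → ℂ} (hc : ContinuousOn h (closedBall 0 1))
    (hi : InjOn h (closedBall 0 1)) {K₁ K₂ : Set ℂ} (hK : Disjoint K₁ K₂)
    (hK₁ : IsPreconnected K₁) (hd₁ : Disjoint K₁ (h '' ball 0 1))
    (hd₂ : Disjoint K₂ (h '' ball 0 1)) (L : ℂ →L[ℝ] ℝ) (r : ℝ)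
    (hLK : ∀ z ∈ sphere (0 : ℂ) 1, L z = r → h z ∈ K₁) {a b : ℂ} (ha : a ∈ sphere (0 : ℂ) 1)
    (hb : b ∈ sphere (0 : ℂ) 1) (hLa : r < L a) (hLb : L b < r) :
    ¬ JoinedIn K₂ (h a) (h b) := by
  intro hab
  set C : Set ℂ := closedBall 0 1 ∩ {z | r ≤ L z} with hCdef
  have hclL : IsClosed {z : ℂ | r ≤ L z} := isClosed_le continuous_const L.continuous
  have hcl : IsClosed C := isClosed_closedBall.inter hclL
  have hconvL : Convex ℝ {z : ℂ | r < L z} := convex_halfSpace_gt L.toLinearMap.isLinear r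
  have hconvL' : Convex ℝ {z : ℂ | L z < r} := convex_halfSpace_lt L.toLinearMap.isLinear r
  have hC : Convex ℝ C :=
    (convex_closedBall _ _).inter (convex_halfSpace_ge L.toLinearMap.isLinear r)
  have hCb : C ⊆ closedBall 0 1 := inter_subset_left
  have hint : ball 0 1 ∩ {z | r < L z} ⊆ interior C :=
    interior_maximal (fun z hz => ⟨ball_subset_closedBall hz.1, (le_of_lt hz.2 : r ≤ L z)⟩)
      (isOpen_ball.inter (isOpen_lt continuous_const L.continuous))
  -- points near a boundary point, in the open disc and on the same side
  have hnear : ∀ x ∈ sphere (0 : ℂ) 1, ∀ O : Set ℂ, IsOpen O → x ∈ O →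
      (ball (0 : ℂ) 1 ∩ O).Nonempty := fun x hx O hO hxO => by
    have : x ∈ closure (ball (0 : ℂ) 1) := by
      rw [closure_ball 0 one_ne_zero]; exact sphere_subset_closedBall hx
    exact inter_comm O _ ▸ mem_closure_iff.mp this O hO hxO
  have hne : (interior C).Nonempty :=
    (hnear a ha _ (isOpen_lt continuous_const L.continuous) hLa).mono hint
  obtain ⟨q, hqb, hqL⟩ := hnear b hb _ (isOpen_lt L.continuous continuous_const) hLb
  obtain ⟨p, hpC, hp⟩ := exists_not_hasLogOn_frontier hC hcl hne
    (isBounded_closedBall.subset hCb) (hc.mono hCb) (hi.mono hCb)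
  have hpb : p ∈ ball (0 : ℂ) 1 := by
    rw [← interior_closedBall (0 : ℂ) one_ne_zero]; exact interior_mono hCb hpC
  have hpL : r < L p := by
    -- Moving an interior point of `C` slightly away from `a` stays in `C`; if `L p ≤ r`, this would
    -- bring `L` below `r`.
    have hcont : Continuous fun t : ℝ => p - t • (a - p) := by fun_prop
    have hev : ∀ᶠ t in nhdsWithin (0 : ℝ) (Ioi 0), p - t • (a - p) ∈ C :=
      (hcont.tendsto' 0 p (by simp)).mono_left nhdsWithin_le_nhds
        (mem_interior_iff_mem_nhds.mp hpC)
    obtain ⟨t, ht, ht0⟩ := (hev.and self_mem_nhdsWithin).exists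
    have h1 : r ≤ L p - t * (L a - L p) := by
      rw [← smul_eq_mul, ← map_sub, ← map_smul, ← map_sub]; exact ht.2
    have h0 : r ≤ L p := (interior_subset hpC).2
    have ht0 : 0 < t := ht0
    by_contra! hle
    nlinarith [mul_pos ht0 (sub_pos.mpr (lt_of_le_of_lt hle hLa))]
  have hball := ball_subset_closedBall (x := (0 : ℂ)) (ε := 1)
  have hsph := sphere_subset_closedBall (x := (0 : ℂ)) (ε := 1)
  have hnot₁ : ∀ z ∈ ball (0 : ℂ) 1, h z ∉ K₁ := fun z hz hz' =>
    disjoint_left.mp hd₁ hz' (mem_image_of_mem h hz)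
  have hnot₂ : ∀ z ∈ ball (0 : ℂ) 1, h z ∉ K₂ := fun z hz hz' =>
    disjoint_left.mp hd₂ hz' (mem_image_of_mem h hz)
  -- joining images of points of the disc by images of segments
  have hseg : ∀ (A T : Set ℂ), Convex ℝ A → A ⊆ closedBall 0 1 → (∀ z ∈ A, h z ∉ T) →
      ∀ x ∈ A, ∀ y ∈ A, JoinedIn Tᶜ (h x) (h y) := fun A T hA hAb hAT x hx y hy => by
    have h1 : JoinedIn (h '' A) (h x) (h y) :=
      ((hA.isPathConnected ⟨x, hx⟩).image' (hc.mono hAb)).joinedIn _ (mem_image_of_mem h hx)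
        _ (mem_image_of_mem h hy)
    exact h1.mono (image_subset_iff.mpr hAT)
  have hsegment : ∀ x ∈ ball (0 : ℂ) 1, ∀ y ∈ sphere (0 : ℂ) 1, ∀ z ∈ segment ℝ x y,
      z ∈ ball (0 : ℂ) 1 ∨ z = y := fun x hx y hy z hz => by
    rcases eq_or_ne z y with rfl | hzy
    · exact Or.inr rfl
    rcases eq_or_ne z x with rfl | hzx
    · exact Or.inl hx
    · have hxy : x ≠ y := by rintro rfl; simp at hz; exact hzx hz
      exact Or.inl <| openSegment_subset_ball_of_ne (hball hx) (hsph hy) hxy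
        (mem_openSegment_of_ne_left_right hzx.symm hzy.symm hz)
  set diam : Set ℂ := closedBall 0 1 ∩ {z | L z = r} with hdiam
  set arc : Set ℂ := sphere 0 1 ∩ {z | r ≤ L z} with harc
  have hK₂diam : ∀ z ∈ diam, h z ∉ K₂ := fun z hz hz' => by
    rcases (mem_closedBall_zero_iff.mp hz.1).lt_or_eq with hlt | heq
    · exact hnot₂ z (mem_ball_zero_iff.mpr hlt) hz'
    · exact disjoint_left.mp hK (hLK z (mem_sphere_zero_iff_norm.mpr heq) hz.2) hz'
  have hside : ∀ x ∈ ball (0 : ℂ) 1, ∀ y ∈ sphere (0 : ℂ) 1, h y ∈ K₂ →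
      (∀ z ∈ segment ℝ x y, L z ≠ r) → JoinedIn (K₁ ∪ h '' diam)ᶜ (h x) (h y) := by
    intro x hx y hy hyK hL
    have hsub : segment ℝ x y ⊆ closedBall 0 1 :=
      (convex_closedBall _ _).segment_subset (hball hx) (hsph hy)
    refine hseg _ _ (convex_segment x y) hsub ?_ x (left_mem_segment ..) y (right_mem_segment ..)
    rintro z hz (hz' | ⟨w, hw, hwz⟩)
    · rcases hsegment x hx y hy z hz with hzb | rfl
      · exact hnot₁ z hzb hz'
      · exact disjoint_left.mp hK hz' hyK
    · rw [hi hw.1 (hsub hz) hwz] at hw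
      exact hL z hz hw.2
  -- The route goes from `p` to `a` on one side of the chord, through `K₂` to `b`, and on to `q` on
  -- the other side.
  have hj₁ : JoinedIn (K₁ ∪ h '' diam)ᶜ (h p) (h q) := by
    refine (hside p hpb a ha hab.source_mem fun z hz => ?_).trans
      ((hab.mono ?_).trans (hside q hqb b hb hab.target_mem fun z hz => ?_).symm)
    · exact (hconvL.segment_subset hpL hLa hz).ne'
    · rintro z hz (hz' | ⟨w, hw, rfl⟩)
      · exact disjoint_left.mp hK hz' hz
      · exact hK₂diam w hw hz
    · exact (hconvL'.segment_subset hqL hLb hz).ne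
  -- Here the route crosses the chord inside the open disc, away from `K₁` and the circle.
  have hj₂ : JoinedIn (K₁ ∪ h '' arc)ᶜ (h p) (h q) := by
    refine hseg _ _ (convex_ball 0 1) hball ?_ p hpb q hqb
    rintro z hz (hz' | ⟨w, hw, hwz⟩)
    · exact hnot₁ z hz hz'
    · rw [hi (hsph hw.1) (hball hz) hwz] at hw
      exact (mem_ball_zero_iff.mp hz).ne (mem_sphere_zero_iff_norm.mp hw.1)
  obtain ⟨g₁, hg₁, hge₁⟩ := HasLogOn.of_joinedIn hj₁
  obtain ⟨g₂, hg₂, hge₂⟩ := HasLogOn.of_joinedIn hj₂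
  -- after adding a constant to one of them, the two logarithms agree on `K₁`
  obtain ⟨d, hdexp, hd⟩ : ∃ d, exp d = 1 ∧ ∀ z ∈ K₁, g₁ z = g₂ z + d := by
    rcases K₁.eq_empty_or_nonempty with rfl | ⟨x, hx⟩
    · exact ⟨0, exp_zero, by simp⟩
    have he : ∀ z ∈ K₁, exp (g₁ z) = exp (g₂ z) := fun z hz =>
      (hge₁ z (Or.inl hz)).trans (hge₂ z (Or.inl hz)).symm
    refine ⟨g₁ x - g₂ x, by rw [exp_sub, he x hx, div_self (exp_ne_zero _)], fun z hz => ?_⟩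
    have := hK₁.sub_eq_sub_of_exp_eq (c := 1) (hg₁.mono subset_union_left)
      (hg₂.mono subset_union_left) (fun z hz => by rw [he z hz, one_mul]) hz hx
    linear_combination this
  have hfr : frontier C ⊆ diam ∪ arc := fun z hz => by
    have hzC : z ∈ C := hcl.frontier_subset hz
    by_cases hzL : L z = r
    · exact Or.inl ⟨hzC.1, hzL⟩
    refine Or.inr ⟨?_, hzC.2⟩
    have : ‖z‖ ≤ 1 := mem_closedBall_zero_iff.mp hzC.1
    refine mem_sphere_zero_iff_norm.mpr (this.antisymm (le_of_not_gt fun hlt => ?_))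
    exact hz.2 (hint ⟨mem_ball_zero_iff.mpr hlt, lt_of_le_of_ne hzC.2 (Ne.symm hzL)⟩)
  have hglue : HasLogOn (fun z => (h z - h p) / (h z - h q)) (frontier C) := by
    classical
    have hdcl : IsClosed diam :=
      isClosed_closedBall.inter (isClosed_eq L.continuous continuous_const)
    have hacl : IsClosed arc := isClosed_sphere.inter hclL
    -- Chord and arc meet only at the ends of the chord, whose images lie in `K₁`; the same constant
    -- `d` works at both.
    have hagree : ∀ z ∈ diam, z ∈ arc → g₁ (h z) = g₂ (h z) + d := fun z hz hz' =>
      hd _ (hLK z hz'.1 hz.2)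
    let g : ℂ → ℂ := fun z => if z ∈ diam then g₁ (h z) else g₂ (h z) + d
    have hgd : EqOn g (fun z => g₁ (h z)) diam := fun z hz => if_pos hz
    have hga : EqOn g (fun z => g₂ (h z) + d) arc := fun z hz => by
      by_cases hzd : z ∈ diam
      · exact (if_pos hzd).trans (hagree z hzd hz)
      · exact if_neg hzd
    refine HasLogOn.mono ⟨g, ContinuousOn.union_of_isClosed ?_ ?_ hdcl hacl, ?_⟩ hfr
    · exact (hg₁.comp (hc.mono inter_subset_left) fun z hz =>
        Or.inr (mem_image_of_mem h hz)).congr hgd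
    · exact ((hg₂.comp (hc.mono (inter_subset_left.trans hsph)) fun z hz =>
        Or.inr (mem_image_of_mem h hz)).add continuousOn_const).congr hga
    · rintro z (hz | hz)
      · rw [hgd hz, hge₁ _ (Or.inr (mem_image_of_mem h hz))]
      · rw [hga hz, exp_add, hdexp, mul_one, hge₂ _ (Or.inr (mem_image_of_mem h hz))]
  have hqC : ∀ z ∈ C, h z - h q ≠ 0 := fun z hz h0 => by
    rw [hi (hCb hz) (hball hqb) (sub_eq_zero.mp h0)] at hz
    exact (show L q < r from hqL).not_ge hz.2
  -- As `q` lies outside `C`, multiplying by this factor turns the logarithm of the quotient into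
  -- one of `h z - h p`.
  have hlogq : HasLogOn (fun z => h z - h q) C :=
    HasLogOn.of_convex hC ((hc.mono hCb).sub continuousOn_const) hqC
  exact hp ((hglue.mul (hlogq.mono hcl.frontier_subset)).congr fun z hz =>
    div_mul_cancel₀ _ (hqC z (hcl.frontier_subset hz)))

/-- The chord from `exp (α I)` to `exp (β I)` separates the two arcs of the circle. -/
theorem im_conj_chord_mul (α β θ : ℝ) :
    ((starRingEnd ℂ) (exp (β * I) - exp (α * I)) * (exp (θ * I) - exp (α * I))).im =
      4 * Real.sin ((β - α) / 2) * Real.sin ((θ - α) / 2) * Real.sin ((θ - β) / 2) := by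
  obtain ⟨x, rfl⟩ : ∃ x, β = α + 2 * x := ⟨(β - α) / 2, by ring⟩
  obtain ⟨y, rfl⟩ : ∃ y, θ = α + 2 * x + 2 * y := ⟨(θ - α - 2 * x) / 2, by ring⟩
  have hcos : ∀ t, Real.cos (2 * t) = 1 - 2 * Real.sin t ^ 2 := fun t => by
    rw [Real.cos_two_mul, Real.cos_sq']; ring
  have hsum : ∀ β θ : ℝ,
      ((starRingEnd ℂ) (exp (β * I) - exp (α * I)) * (exp (θ * I) - exp (α * I))).im =
        Real.sin (θ - β) + Real.sin (β - α) - Real.sin (θ - α) := fun β θ => by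
    simp only [mul_im, conj_re, conj_im, sub_re, sub_im, exp_ofReal_mul_I_re, exp_ofReal_mul_I_im,
      map_sub, Real.sin_sub]
    ring
  rw [hsum, show α + 2 * x + 2 * y - (α + 2 * x) = 2 * y by ring,
    show α + 2 * x - α = 2 * x by ring, show α + 2 * x + 2 * y - α = 2 * x + 2 * y by ring,
    show (2 * x + 2 * y) / 2 = x + y by ring, Real.sin_add, Real.sin_add, Real.sin_two_mul,
    Real.sin_two_mul, hcos, hcos, mul_div_cancel_left₀ _ (two_ne_zero' ℝ),
    mul_div_cancel_left₀ _ (two_ne_zero' ℝ)]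
  ring

/-- Two disjoint connected sets outside an embedded disc cannot join two pairs of points of the
boundary circle that separate each other. -/
theorem not_joinedIn_of_cyclic_order {h : ℂ → ℂ} (hc : ContinuousOn h (closedBall 0 1))
    (hi : InjOn h (closedBall 0 1)) {K₁ K₂ : Set ℂ} (hK : Disjoint K₁ K₂)
    (hK₁ : IsPreconnected K₁) (hd₁ : Disjoint K₁ (h '' ball 0 1))
    (hd₂ : Disjoint K₂ (h '' ball 0 1)) {α β γ δ : ℝ} (hαβ : α < β) (hβγ : β < γ) (hγδ : γ < δ)
    (hδα : δ < α + 2 * Real.pi) (hα : h (exp (α * I)) ∈ K₁) (hγ : h (exp (γ * I)) ∈ K₁) :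
    ¬ JoinedIn K₂ (h (exp (β * I))) (h (exp (δ * I))) := by
  intro hj
  have hmem : ∀ t : ℝ, exp (t * I) ∈ sphere (0 : ℂ) 1 := fun t => by
    simp [norm_exp_ofReal_mul_I]
  let L : ℂ →L[ℝ] ℝ :=
    imCLM.comp (ContinuousLinearMap.mul ℝ ℂ ((starRingEnd ℂ) (exp (γ * I) - exp (α * I))))
  have hL : ∀ t : ℝ, L (exp (t * I)) - L (exp (α * I)) =
      4 * Real.sin ((γ - α) / 2) * Real.sin ((t - α) / 2) * Real.sin ((t - γ) / 2) := fun t => by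
    rw [← im_conj_chord_mul, ← map_sub]; rfl
  have hpos : ∀ x : ℝ, 0 < x → x < 2 * Real.pi → 0 < Real.sin (x / 2) := fun x h0 h1 =>
    Real.sin_pos_of_pos_of_lt_pi (by linarith) (by linarith)
  have hs : 0 < Real.sin ((γ - α) / 2) := hpos _ (by linarith) (by linarith)
  refine not_joinedIn_of_separated_in_disc hc hi hK hK₁ hd₁ hd₂ L (L (exp (α * I))) ?_
    (hmem δ) (hmem β) ?_ ?_ hj.symm
  · intro z hz hLz
    -- With the angle taken in this interval, the product of sines vanishes only at `t = α` and `t =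
    -- γ`.
    obtain ⟨t, ht, rfl⟩ : ∃ t ∈ Ico α (α + 2 * Real.pi), exp (t * I) = z := by
      have hz1 := mem_sphere_zero_iff_norm.mp hz
      refine ⟨toIcoMod Real.two_pi_pos α (arg z), toIcoMod_mem_Ico _ _ _, ?_⟩
      rw [toIcoMod]
      have := norm_mul_exp_arg_mul_I z
      rw [hz1, ofReal_one, one_mul] at this
      conv_rhs => rw [← this]
      refine exp_eq_exp_iff_exists_int.mpr ⟨-toIcoDiv Real.two_pi_pos α (arg z), ?_⟩
      push_cast [zsmul_eq_mul]
      ring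
    have h0 := hL t
    rw [hLz, sub_self, eq_comm] at h0
    rcases ht.1.eq_or_lt with rfl | hlt
    · exact hα
    have h1 : Real.sin ((t - α) / 2) ≠ 0 := (hpos _ (by linarith) (by linarith [ht.2])).ne'
    have h2 : Real.sin ((t - γ) / 2) = 0 := by
      simpa [hs.ne', h1] using h0
    rw [Real.sin_eq_zero_iff_of_lt_of_lt (by linarith) (by linarith [ht.2])] at h2
    rwa [show t = γ by linarith]
  · rw [← sub_pos, hL]
    exact mul_pos (mul_pos (mul_pos four_pos hs) (hpos _ (by linarith) (by linarith)))
      (hpos _ (by linarith) (by linarith))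
  · rw [← sub_neg, hL]
    refine mul_neg_of_pos_of_neg (mul_pos (mul_pos four_pos hs)
      (hpos _ (by linarith) (by linarith))) ?_
    rw [← neg_sub, neg_div, Real.sin_neg, neg_lt_zero]
    exact hpos _ (by linarith) (by linarith)

/-! ### Connected subgraphs of a plane drawing. -/

namespace PlaneDrawing

variable {W : Type*} {G : SimpleGraph W}

/-- The part of the drawing formed by the vertices in `T` and the edges between them. -/
def part (D : PlaneDrawing G) (T : Set W) : Set ℂ :=
  D.pos '' T ∪ ⋃ e : {e : G.edgeSet // ∀ v ∈ (e : Sym2 W), v ∈ T}, range (D.curve e)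

theorem part_subset_carrier (D : PlaneDrawing G) (T : Set W) : D.part T ⊆ D.carrier :=
  union_subset_union (image_subset_range _ _)
    (iUnion_subset fun e => subset_iUnion (fun e => range (D.curve e)) e.1)

theorem pos_mem_part (D : PlaneDrawing G) {T : Set W} {v : W} (hv : v ∈ T) :
    D.pos v ∈ D.part T :=
  Or.inl (mem_image_of_mem _ hv)

theorem exists_pos_eq_curve (D : PlaneDrawing G) (e : G.edgeSet) {t : unitInterval}
    (ht : t = 0 ∨ t = 1) : ∃ v ∈ (e : Sym2 W), D.pos v = D.curve e t := by
  have h : D.curve e t ∈ Sym2.map D.pos (e : Sym2 W) := by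
    rw [← D.curve_ends e]
    rcases ht with rfl | rfl <;> simp
  exact Sym2.mem_map.mp h

/-- A vertex lying on an edge is an end of that edge. -/
theorem mem_of_pos_eq_curve (D : PlaneDrawing G) {e : G.edgeSet} {t : unitInterval} {v : W}
    (h : D.pos v = D.curve e t) : v ∈ (e : Sym2 W) := by
  have ht : t = 0 ∨ t = 1 := by
    by_contra! hne
    exact D.curve_interior e t ⟨unitInterval.pos_iff_ne_zero.mpr hne.1,
      unitInterval.lt_one_iff_ne_one.mpr hne.2⟩ ⟨v, h⟩
  obtain ⟨u, hu, hpos⟩ := D.exists_pos_eq_curve e ht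
  rwa [D.pos_injective (h.trans hpos.symm)]

/-- A vertex whose point lies in `D.part T` belongs to `T`, so a common point is not a vertex. It
would lie on an edge of each part; distinct edges meet only in vertices, and a common edge would
have its ends in both sets. -/
theorem disjoint_part (D : PlaneDrawing G) {T T' : Set W} (h : Disjoint T T') :
    Disjoint (D.part T) (D.part T') := by
  have key : ∀ {T : Set W} {v : W}, D.pos v ∈ D.part T → v ∈ T := by
    rintro T v (⟨u, hu, huv⟩ | hv)
    · rwa [← D.pos_injective huv]
    · obtain ⟨⟨e, he⟩, t, ht⟩ := mem_iUnion.mp hv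
      exact he v (D.mem_of_pos_eq_curve ht.symm)
  refine disjoint_left.mpr fun z hz hz' => ?_
  have hpos : ∀ v, D.pos v ≠ z := by
    rintro v rfl
    exact disjoint_left.mp h (key hz) (key hz')
  rcases hz with ⟨v, -, hv⟩ | hz
  · exact hpos v hv
  rcases hz' with ⟨v, -, hv⟩ | hz'
  · exact hpos v hv
  obtain ⟨⟨e, he⟩, t, ht⟩ := mem_iUnion.mp hz
  obtain ⟨⟨e', he'⟩, t', ht'⟩ := mem_iUnion.mp hz'
  by_cases hee : e = e'
  · subst hee
    obtain ⟨v, hv, -⟩ := D.exists_pos_eq_curve e (t := 0) (Or.inl rfl)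
    exact disjoint_left.mp h (he v hv) (he' v hv)
  · obtain ⟨v, hv⟩ := D.curve_inter e e' t t' hee (ht.trans ht'.symm)
    exact hpos v (hv.trans ht)

theorem joinedIn_part_of_mem_edge (D : PlaneDrawing G) {T : Set W} (e : G.edgeSet)
    (he : ∀ v ∈ (e : Sym2 W), v ∈ T) {z z' : ℂ} (hz : z ∈ range (D.curve e))
    (hz' : z' ∈ range (D.curve e)) : JoinedIn (D.part T) z z' := by
  have : PathConnectedSpace unitInterval := isPathConnected_iff_pathConnectedSpace.mp
    ((convex_Icc (0 : ℝ) 1).isPathConnected ⟨0, by simp⟩)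
  have h : IsPathConnected (range (D.curve e)) := isPathConnected_range (D.curve e).continuous
  refine (h.joinedIn z hz z' hz').mono fun x hx => Or.inr (mem_iUnion.mpr ⟨⟨e, he⟩, hx⟩)

theorem pos_mem_range_curve (D : PlaneDrawing G) {e : G.edgeSet} {v : W} (hv : v ∈ (e : Sym2 W)) :
    D.pos v ∈ range (D.curve e) := by
  have h : D.pos v ∈ Sym2.map D.pos (e : Sym2 W) := Sym2.mem_map.mpr ⟨v, hv, rfl⟩
  rw [← D.curve_ends e, Sym2.mem_iff] at h
  rcases h with h | h <;> exact ⟨_, h.symm⟩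

theorem joinedIn_part (D : PlaneDrawing G) {T : Set W} (hT : (G.induce T).Preconnected)
    {u v : W} (hu : u ∈ T) (hv : v ∈ T) : JoinedIn (D.part T) (D.pos u) (D.pos v) := by
  obtain ⟨p⟩ := hT ⟨u, hu⟩ ⟨v, hv⟩
  suffices H : ∀ {x y : T}, (G.induce T).Walk x y → JoinedIn (D.part T) (D.pos x) (D.pos y) from H p
  intro x y p
  induction p with
  | nil => exact JoinedIn.refl (D.pos_mem_part (Subtype.coe_prop _))
  | @cons x y _ hxy _ ih =>
    refine JoinedIn.trans ?_ ih
    have hadj : G.Adj x y := hxy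
    refine D.joinedIn_part_of_mem_edge ⟨s(x, y), hadj⟩ (fun w hw => ?_)
      (D.pos_mem_range_curve (Sym2.mem_mk_left ..)) (D.pos_mem_range_curve (Sym2.mem_mk_right ..))
    rcases Sym2.mem_iff.mp hw with rfl | rfl
    exacts [x.2, y.2]

theorem isPreconnected_part (D : PlaneDrawing G) {T : Set W} (hT : (G.induce T).Preconnected) :
    IsPreconnected (D.part T) := by
  rcases T.eq_empty_or_nonempty with rfl | ⟨u, hu⟩
  · have : D.part ∅ = ∅ := by
      refine eq_empty_of_forall_notMem ?_
      rintro z (⟨v, hv, -⟩ | hz)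
      · exact hv
      · obtain ⟨⟨e, he⟩, -⟩ := mem_iUnion.mp hz
        obtain ⟨v, hv, -⟩ := D.exists_pos_eq_curve e (t := 0) (Or.inl rfl)
        exact he v hv
    rw [this]
    exact isPreconnected_empty
  · refine IsConnected.isPreconnected (IsPathConnected.isConnected
      ⟨D.pos u, D.pos_mem_part hu, fun {z} hz => ?_⟩)
    rcases hz with ⟨v, hv, rfl⟩ | hz
    · exact D.joinedIn_part hT hu hv
    · obtain ⟨⟨e, he⟩, hz⟩ := mem_iUnion.mp hz
      obtain ⟨v, hv, -⟩ := D.exists_pos_eq_curve e (t := 0) (Or.inl rfl)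
      exact (D.joinedIn_part hT hu (he v hv)).trans
        (D.joinedIn_part_of_mem_edge e he (D.pos_mem_range_curve hv) hz)

theorem IsFace.disjoint_carrier {D : PlaneDrawing G} {F : Set ℂ} (hF : D.IsFace F) :
    Disjoint F D.carrier := by
  obtain ⟨z, -, rfl⟩ := hF
  exact disjoint_compl_left_iff_subset.mpr (subset_refl _) |>.mono_left
    (connectedComponentIn_subset _ _)

theorem InCyclicOrderOn.injective {D : PlaneDrawing G} {F : Set ℂ} {m : ℕ} {c : Fin m → W}
    (hc : D.InCyclicOrderOn F c) : Function.Injective c := by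
  obtain ⟨h, θ, -, hi, hθ, hθm, hh, -⟩ := hc
  have hmem : ∀ i, exp (θ i * I) ∈ closedBall (0 : ℂ) 1 := fun i => by
    simp [norm_exp_ofReal_mul_I]
  intro i i' hii
  have := hi (hmem i) (hmem i') ((hh i).trans ((congrArg D.pos hii).trans (hh i').symm))
  exact hθ.injective (Circle.exp_injOn_Ico (by simp) (hθm i) (hθm i') (Circle.ext (by simpa)))

/-- Disjoint connected subgraphs cannot join two pairs of vertices that separate each other in the
cyclic order on a face. -/
theorem InCyclicOrderOn.not_disjoint {D : PlaneDrawing G} {F : Set ℂ} (hF : D.IsFace F) {m : ℕ}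
    {c : Fin m → W} (hc : D.InCyclicOrderOn F c) {i₁ i₂ i₃ i₄ : Fin m} (h₁₂ : i₁ < i₂)
    (h₂₃ : i₂ < i₃) (h₃₄ : i₃ < i₄) {T T' : Set W} (hT : (G.induce T).Preconnected)
    (hT' : (G.induce T').Preconnected) (h₁ : c i₁ ∈ T) (h₃ : c i₃ ∈ T) (h₂ : c i₂ ∈ T')
    (h₄ : c i₄ ∈ T') : ¬ Disjoint T T' := by
  intro hTT
  obtain ⟨h, θ, hcont, hi, hθ, hθm, hh, hface⟩ := hc
  -- The exceptional points of the disc have norm one, so the open disc is mapped into the face,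
  -- which misses the drawing.
  have hball : ∀ S : Set W, Disjoint (D.part S) (h '' ball 0 1) := fun S => by
    refine disjoint_right.mpr ?_
    rintro _ ⟨z, hz, rfl⟩ hzS
    refine disjoint_left.mp hF.disjoint_carrier (hface z (ball_subset_closedBall hz) ?_)
      (D.part_subset_carrier S hzS)
    rintro i rfl
    simp [norm_exp_ofReal_mul_I] at hz
  refine not_joinedIn_of_cyclic_order hcont hi (D.disjoint_part hTT) (D.isPreconnected_part hT)
    (hball T) (hball T') (hθ h₁₂) (hθ h₂₃) (hθ h₃₄)
    (by linarith [(hθm i₄).2, (hθm i₁).1]) ?_ ?_ ?_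
  · rw [hh]; exact D.pos_mem_part h₁
  · rw [hh]; exact D.pos_mem_part h₃
  · rw [hh, hh]; exact D.joinedIn_part hT' h₂ h₄

end PlaneDrawing

/-! ### Joint orbits of two involutions: alternating paths and their ends. -/

section Involutions

variable {W : Type*}

/-- The set of points that can be reached from `x` by applying `f` and `g` repeatedly. If `f` and
`g` are involutions whose moved points are matched by two matchings, then this is the component of
`x` in the superposition of the two matchings. -/
def jointOrbit (f g : W → W) (x : W) : Set W :=
  {y | Relation.ReflTransGen (fun u v => v = f u ∨ v = g u) x y}

variable {f g : W → W} {x y : W}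

theorem mem_jointOrbit_self : x ∈ jointOrbit f g x := Relation.ReflTransGen.refl

theorem jointOrbit_comm (f g : W → W) (x : W) : jointOrbit f g x = jointOrbit g f x := by
  simp only [jointOrbit, or_comm]

theorem apply_left_mem_jointOrbit (h : y ∈ jointOrbit f g x) : f y ∈ jointOrbit f g x :=
  Relation.ReflTransGen.tail h (Or.inl rfl)

theorem apply_right_mem_jointOrbit (h : y ∈ jointOrbit f g x) : g y ∈ jointOrbit f g x :=
  Relation.ReflTransGen.tail h (Or.inr rfl)

theorem mem_jointOrbit_comm (hf : f.Involutive) (hg : g.Involutive) (h : y ∈ jointOrbit f g x) :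
    x ∈ jointOrbit f g y := by
  have : Std.Symm fun u v => v = f u ∨ v = g u := ⟨by
    rintro u v (rfl | rfl)
    · exact Or.inl (hf u).symm
    · exact Or.inr (hg u).symm⟩
  exact Relation.ReflTransGen.stdSymm.symm _ _ h

theorem mem_jointOrbit_trans {z : W} (h : y ∈ jointOrbit f g x) (h' : z ∈ jointOrbit f g y) :
    z ∈ jointOrbit f g x :=
  Relation.ReflTransGen.trans h h'

theorem apply_left_mem_jointOrbit_iff (hf : f.Involutive) :
    f y ∈ jointOrbit f g x ↔ y ∈ jointOrbit f g x :=
  ⟨fun h => hf y ▸ apply_left_mem_jointOrbit h, apply_left_mem_jointOrbit⟩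

theorem apply_right_mem_jointOrbit_iff (hg : g.Involutive) :
    g y ∈ jointOrbit f g x ↔ y ∈ jointOrbit f g x :=
  ⟨fun h => hg y ▸ apply_right_mem_jointOrbit h, apply_right_mem_jointOrbit⟩

/-- Each application of `f` or `g` stays put or follows an edge. This lets orbits serve as the
connected subgraphs in the noncrossing statement. -/
theorem preconnected_induce_jointOrbit {G : SimpleGraph W}
    (hf : ∀ z, f z ≠ z → G.Adj z (f z)) (hg : ∀ z, g z ≠ z → G.Adj z (g z)) (x : W) :
    (G.induce (jointOrbit f g x)).Preconnected := by
  have key : ∀ y (hy : y ∈ jointOrbit f g x),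
      (G.induce (jointOrbit f g x)).Reachable ⟨x, mem_jointOrbit_self⟩ ⟨y, hy⟩ := by
    intro y hy
    induction hy using Relation.ReflTransGen.rec with
    | refl => exact SimpleGraph.Reachable.refl _
    | @tail u v hu huv ih =>
      rcases eq_or_ne v u with rfl | hne
      · exact ih
      refine ih.trans (SimpleGraph.Adj.reachable (show G.Adj u v from ?_))
      rcases huv with rfl | rfl
      · exact hf u hne
      · exact hg u hne
  exact fun u v => (key u u.2).symm.trans (key v v.2)

/-- An orbit of two involutions that contains an end, that is a point fixed by one of them but not
by both, contains exactly one other end. -/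
theorem exists_other_end [Finite W] (hf : f.Involutive) (hg : g.Involutive)
    (hfx : f x = x) (hgx : g x ≠ x) :
    ∃ y ∈ jointOrbit f g x, y ≠ x ∧ (f y = y ∨ g y = y) ∧
      ∀ z ∈ jointOrbit f g x, f z = z ∨ g z = z → z = x ∨ z = y := by
  -- The two involutions generate a dihedral action. As `f` fixes `x`, the orbit is a copy of `ℤ /
  -- N` on which `f` acts as `n ↦ -n` and `g` as `n ↦ 1 - n`; the ends are the solutions of `2 * n =
  -- 0` and `2 * n = 1`.
  set p : Equiv.Perm W := hg.toPerm * hf.toPerm with hp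
  have hpv : ∀ z, p z = g (f z) := fun z => rfl
  have hfp : ∀ n : ℤ, f ((p ^ n) x) = (p ^ (-n)) x := fun n => by
    have h1 : hf.toPerm * p * hf.toPerm⁻¹ = p⁻¹ := by
      rw [hp, mul_inv_rev, mul_assoc, mul_assoc, mul_inv_cancel, mul_one]
      have e1 : hf.toPerm⁻¹ = hf.toPerm := rfl
      have e2 : hg.toPerm⁻¹ = hg.toPerm := rfl
      rw [e1, e2]
    have h2 : hf.toPerm * p ^ n * hf.toPerm⁻¹ = p ^ (-n) := by
      rw [← conj_zpow, h1, inv_zpow, zpow_neg]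
    have h3 := congrArg (fun q : Equiv.Perm W => q (f x)) h2
    simp only [Equiv.Perm.mul_apply] at h3
    have h4 : hf.toPerm⁻¹ (f x) = x := hf x
    rwa [h4, hfx] at h3
  have hgp : ∀ n : ℤ, g ((p ^ n) x) = (p ^ (1 - n)) x := fun n => by
    rw [sub_eq_add_neg, zpow_add, zpow_one, Equiv.Perm.mul_apply, ← hfp, hpv, hf]
  have hmem : ∀ n : ℤ, (p ^ n) x ∈ jointOrbit f g x := by
    have hstep : ∀ z, z ∈ jointOrbit f g x → p z ∈ jointOrbit f g x := fun z hz =>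
      apply_right_mem_jointOrbit (apply_left_mem_jointOrbit hz)
    have hnat : ∀ n : ℕ, (p ^ n) x ∈ jointOrbit f g x := fun n => by
      induction n with
      | zero => exact mem_jointOrbit_self
      | succ n ih => rw [pow_succ']; exact hstep _ ih
    intro n
    obtain ⟨n, rfl | rfl⟩ := n.eq_nat_or_neg
    · exact_mod_cast hnat n
    · rw [← hfp]; exact apply_left_mem_jointOrbit (by exact_mod_cast hnat n)
  have hall : ∀ z ∈ jointOrbit f g x, ∃ n : ℤ, z = (p ^ n) x := fun z hz => by
    induction hz with
    | refl => exact ⟨0, rfl⟩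
    | tail _ h ih =>
      obtain ⟨n, rfl⟩ := ih
      rcases h with rfl | rfl
      · exact ⟨-n, hfp n⟩
      · exact ⟨1 - n, hgp n⟩
  set N : ℕ := Function.minimalPeriod p x with hN
  have hNpos : 0 < N := Function.minimalPeriod_pos_of_mem_periodicPts
    (p.injective.mem_periodicPts x)
  have hdvd : ∀ n : ℤ, (p ^ n) x = x ↔ (N : ℤ) ∣ n := fun n =>
    MulAction.zpow_smul_eq_iff_minimalPeriod_dvd (a := p) (b := x) (n := n)
  have heq : ∀ m n : ℤ, (p ^ m) x = (p ^ n) x ↔ (N : ℤ) ∣ m - n := fun m n => by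
    rw [← hdvd, sub_eq_neg_add, zpow_add, zpow_neg, Equiv.Perm.mul_apply, Equiv.Perm.inv_eq_iff_eq]
  have hN1 : N ≠ 1 := fun h1 => by
    have : (p ^ (1 : ℤ)) x = x := by rw [hdvd, h1]; exact one_dvd _
    rw [zpow_one, hpv, hfx] at this
    exact hgx this
  have hfix : ∀ n : ℤ, (f ((p ^ n) x) = (p ^ n) x ↔ (N : ℤ) ∣ 2 * n) ∧
      (g ((p ^ n) x) = (p ^ n) x ↔ (N : ℤ) ∣ 2 * n - 1) := fun n => by
    rw [hfp, hgp, heq, heq, ← dvd_neg, ← dvd_neg (b := 1 - n - n)]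
    constructor <;> ring_nf
  -- The other end is at `N / 2`, fixed by `f`, if `N` is even, and at `(N + 1) / 2`, fixed by `g`,
  -- if `N` is odd.
  obtain ⟨m, hm⟩ : ∃ m : ℤ, (N : ℤ) = 2 * m ∨ (N : ℤ) = 2 * m - 1 := by
    refine ⟨(N + 1) / 2, by omega⟩
  refine ⟨(p ^ m) x, hmem m, fun h => ?_, ?_, fun z hz hzfix => ?_⟩
  · rw [hdvd] at h
    have := Int.le_of_dvd (by omega) h
    omega
  · rw [(hfix m).1, (hfix m).2]
    rcases hm with hm | hm
    · exact Or.inl (dvd_of_eq hm)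
    · exact Or.inr (dvd_of_eq hm)
  · obtain ⟨n, rfl⟩ := hall z hz
    rw [(hfix n).1, (hfix n).2] at hzfix
    rw [hdvd, heq]
    have hodd : (N : ℤ) = 2 * m - 1 → ∀ t : ℤ, (N : ℤ) ∣ 2 * t → (N : ℤ) ∣ t := fun h t ht => by
      refine IsCoprime.dvd_of_dvd_mul_left ⟨-1, m, by rw [h]; ring⟩ ht
    rcases hzfix with ⟨t, ht⟩ | ⟨t, ht⟩
    · rcases hm with hm | hm
      · have hnt : n = m * t := by rw [hm] at ht; linarith
        obtain ⟨s, hs | hs⟩ := t.even_or_odd'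
        · exact Or.inl ⟨s, by rw [hnt, hs, hm]; ring⟩
        · exact Or.inr ⟨s, by rw [hnt, hs, hm]; ring⟩
      · exact Or.inl (hodd hm n ⟨t, ht⟩)
    · rcases hm with hm | hm
      · exfalso
        rw [hm, mul_assoc] at ht
        omega
      · exact Or.inr (hodd hm _ ⟨t - 1, by rw [mul_sub, mul_sub, ← sub_add_cancel (2 * n) 1, ht, hm]; ring⟩)

/-- If two involutions change the sign `s` of the points they move, then the two ends in one of
their orbits have opposite signs if they are fixed by the same involution, and equal signs
otherwise. -/
theorem sign_ends [Finite W] (hf : f.Involutive) (hg : g.Involutive) (s : W → ℤ)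
    (hsf : ∀ z, f z ≠ z → s (f z) = -s z) (hsg : ∀ z, g z ≠ z → s (g z) = -s z)
    (hfg : ∀ z, f z = z → g z ≠ z) (hfx : f x = x) (hy : y ∈ jointOrbit f g x) (hyx : y ≠ x)
    (hends : ∀ z ∈ jointOrbit f g x, f z = z ∨ g z = z → z = x ∨ z = y) :
    (f y = y → s y = -s x) ∧ (g y = y → s y = s x) := by
  classical
  have := Fintype.ofFinite W
  -- The sum of `s` over the orbit equals its sum over the fixed points of either involution,
  -- because moved points cancel in pairs. Comparing the two evaluations relates the signs of the
  -- ends.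
  have key : ∀ h : W → W, h.Involutive → (∀ z, h z ≠ z → s (h z) = -s z) →
      (∀ z, z ∈ jointOrbit f g x → h z ∈ jointOrbit f g x) →
      ∑ z ∈ (jointOrbit f g x).toFinset, s z =
        ∑ z ∈ (jointOrbit f g x).toFinset with h z = z, s z := fun h hh hs hT => by
    rw [← Finset.sum_filter_add_sum_filter_not _ (fun z => h z = z), add_eq_left]
    refine Finset.sum_involution (fun z _ => h z) (fun z hz => ?_) (fun z hz _ => ?_)
      (fun z hz => ?_) (fun z _ => hh z)
    · rw [hs z (Finset.mem_filter.mp hz).2, add_neg_cancel]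
    · exact (Finset.mem_filter.mp hz).2
    · simp only [Finset.mem_filter, Set.mem_toFinset] at hz ⊢
      exact ⟨hT z hz.1, fun h' => hz.2 (hh.injective h')⟩
  have hsum := (key f hf hsf fun z => apply_left_mem_jointOrbit).symm.trans
    (key g hg hsg fun z => apply_right_mem_jointOrbit)
  have hgx := hfg x hfx
  constructor
  · intro hfy
    have e1 : (jointOrbit f g x).toFinset.filter (fun z => f z = z) = {x, y} := by
      ext z
      simp only [Finset.mem_filter, Set.mem_toFinset, Finset.mem_insert, Finset.mem_singleton]
      refine ⟨fun h => hends z h.1 (Or.inl h.2), ?_⟩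
      rintro (rfl | rfl)
      exacts [⟨mem_jointOrbit_self, hfx⟩, ⟨hy, hfy⟩]
    have e2 : (jointOrbit f g x).toFinset.filter (fun z => g z = z) = ∅ := by
      refine Finset.filter_eq_empty_iff.mpr fun z hz hgz => ?_
      rcases hends z (Set.mem_toFinset.mp hz) (Or.inr hgz) with rfl | rfl
      exacts [hgx hgz, hfg _ hfy hgz]
    rw [e1, e2, Finset.sum_pair hyx.symm, Finset.sum_empty] at hsum
    linarith
  · intro hgy
    have hfy : f y ≠ y := fun h => hfg y h hgy
    have e1 : (jointOrbit f g x).toFinset.filter (fun z => f z = z) = {x} := by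
      ext z
      simp only [Finset.mem_filter, Set.mem_toFinset, Finset.mem_singleton]
      refine ⟨fun h => (hends z h.1 (Or.inl h.2)).resolve_right ?_, ?_⟩
      · rintro rfl; exact hfy h.2
      · rintro rfl; exact ⟨mem_jointOrbit_self, hfx⟩
    have e2 : (jointOrbit f g x).toFinset.filter (fun z => g z = z) = {y} := by
      ext z
      simp only [Finset.mem_filter, Set.mem_toFinset, Finset.mem_singleton]
      refine ⟨fun h => (hends z h.1 (Or.inr h.2)).resolve_left ?_, ?_⟩
      · rintro rfl; exact hgx h.2
      · rintro rfl; exact ⟨hy, hgy⟩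
    rw [e1, e2, Finset.sum_singleton, Finset.sum_singleton] at hsum
    exact hsum.symm

/-- In a noncrossing system of orbits of two involutions, ends in the same orbit are at positions
of different parity in the cyclic order. -/
theorem odd_add_of_mem_jointOrbit [Finite W] {G : SimpleGraph W} {D : PlaneDrawing G} {F : Set ℂ}
    (hF : D.IsFace F) {m : ℕ} {c : Fin m → W} (hc : D.InCyclicOrderOn F c)
    (hf : f.Involutive) (hg : g.Involutive) (hfG : ∀ z, f z ≠ z → G.Adj z (f z))
    (hgG : ∀ z, g z ≠ z → G.Adj z (g z)) (hfg : ∀ z, f z = z → g z ≠ z)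
    (hends : ∀ z, z ∈ range c ↔ f z = z ∨ g z = z) {p q : Fin m} (hpq : p < q)
    (hmem : c q ∈ jointOrbit f g (c p)) : Odd (p + q : ℕ) := by
  have hinj := hc.injective
  have hother : ∀ i, ∃ i', i' ≠ i ∧ c i' ∈ jointOrbit f g (c i) ∧
      ∀ l, c l ∈ jointOrbit f g (c i) → l = i ∨ l = i' := fun i => by
    obtain ⟨y, hy, hyi, hyfix, hall⟩ : ∃ y ∈ jointOrbit f g (c i), y ≠ c i ∧ (f y = y ∨ g y = y) ∧
        ∀ z ∈ jointOrbit f g (c i), f z = z ∨ g z = z → z = c i ∨ z = y := by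
      rcases (hends (c i)).mp (mem_range_self i) with h | h
      · exact exists_other_end hf hg h (hfg _ h)
      · obtain ⟨y, hy, hyi, hyfix, hall⟩ := exists_other_end hg hf h (fun h' => hfg _ h' h)
        rw [jointOrbit_comm] at hy hall
        exact ⟨y, hy, hyi, hyfix.symm, fun z hz hz' => hall z hz hz'.symm⟩
    obtain ⟨i', rfl⟩ := (hends y).mpr hyfix
    refine ⟨i', fun h => hyi (h ▸ rfl), hy, fun l hl => ?_⟩
    exact (hall (c l) hl ((hends _).mp (mem_range_self l))).imp (fun h => hinj h) (fun h => hinj h)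
  choose σ hσne hσmem hσ using hother
  have hσσ : ∀ i, σ (σ i) = i := fun i =>
    ((hσ (σ i) i (mem_jointOrbit_comm hf hg (hσmem i))).resolve_left (hσne i).symm).symm
  have hσp : σ p = q := ((hσ p q hmem).resolve_left hpq.ne').symm
  -- If `σ r` were outside the interval, the disjoint orbits of `c p` and `c r` would cross.
  have hσIoo : ∀ r ∈ Finset.Ioo p q, σ r ∈ Finset.Ioo p q := fun r hr => by
    rw [Finset.mem_Ioo] at hr ⊢
    have hdisj : Disjoint (jointOrbit f g (c p)) (jointOrbit f g (c r)) := by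
      refine disjoint_left.mpr fun z hz hz' => ?_
      have := hσ p r (mem_jointOrbit_trans hz (mem_jointOrbit_comm hf hg hz'))
      rw [hσp] at this
      rcases this with rfl | rfl
      exacts [lt_irrefl _ hr.1, lt_irrefl _ hr.2]
    have hconn := preconnected_induce_jointOrbit hfG hgG
    have hrp : σ r ≠ p := fun h => by
      have := hσσ r
      rw [h, hσp] at this
      exact hr.2.ne this.symm
    have hrq : σ r ≠ q := fun h => by
      have := hσσ r
      rw [h, ← hσp, hσσ] at this
      exact hr.1.ne this
    by_contra hnot
    rcases hrp.lt_or_gt with hlt | hgt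
    · exact hc.not_disjoint hF hlt hr.1 hr.2 (hconn (c r)) (hconn (c p)) (hσmem r)
        mem_jointOrbit_self mem_jointOrbit_self hmem hdisj.symm
    · have hgt' : q < σ r := hrq.lt_or_gt.resolve_left fun h => hnot ⟨hgt, h⟩
      exact hc.not_disjoint hF hr.1 hr.2 hgt' (hconn (c p)) (hconn (c r)) mem_jointOrbit_self hmem
        mem_jointOrbit_self (hσmem r) hdisj
  -- The partner map `σ` has no fixed points, so it pairs off the interval; its size `q - p - 1` is
  -- then even.
  have heven : Even (Finset.Ioo p q).card := by
    have h0 : ∑ _r ∈ Finset.Ioo p q, (1 : ZMod 2) = 0 :=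
      Finset.sum_involution (fun r _ => σ r) (fun _ _ => by decide) (fun r _ _ => hσne r)
        (fun r hr => hσIoo r hr) (fun r _ => hσσ r)
    rw [Finset.sum_const, nsmul_eq_mul, mul_one, ZMod.natCast_eq_zero_iff] at h0
    exact even_iff_two_dvd.mpr h0
  rw [Fin.card_Ioo] at heven
  have hlt : (p : ℕ) < q := hpq
  rw [Nat.odd_iff]
  rw [Nat.even_iff] at heven
  omega

end Involutions

/-! ### Perfect matchings as involutions, and exchange along an orbit. -/

section MatchingInvolutions

variable {W : Type*}

/-- The perfect matchings of `G - S`, encoded as involutions of the vertex set of `G` whose fixed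
points are the vertices in `S`. -/
structure IsMatchingInvolution (G : SimpleGraph W) (S : Set W) (f : W → W) : Prop where
  involutive : f.Involutive
  apply_eq_iff : ∀ x, f x = x ↔ x ∈ S
  adj : ∀ x, f x ≠ x → G.Adj x (f x)

open Classical in
/-- The weight of a matching in a bipartite graph: the edges are indexed by their ends in `U`. -/
noncomputable def involutionWeight {R : Type*} [CommSemiring R] [Fintype W] (w : Sym2 W → R)
    (U : Set W) (f : W → W) : R :=
  ∏ u with u ∈ U ∧ f u ≠ u, w s(u, f u)

/-- Every edge has exactly one end in `U`, so the edges of the matching correspond to the vertices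
of `U` that are not deleted. -/
theorem prod_edgeSet_eq_involutionWeight {R X : Type*} [CommSemiring R] [Fintype W] [Finite X]
    {G : SimpleGraph W} {U V : Set W} (hbip : G.IsBipartiteWith U V) (hUV : U ∪ V = univ)
    {H : SimpleGraph X} {e : X → W} (he : e.Injective) (P : H.Subgraph) {f : W → W}
    (hf : IsMatchingInvolution G (range e)ᶜ f) (hP : ∀ x y, P.Adj x y ↔ f (e x) = e y)
    (w : Sym2 W → R) :
    ∏ᶠ z : P.edgeSet, w (Sym2.map e z) = involutionWeight w U f := by
  classical
  have := Fintype.ofFinite X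
  have hV : ∀ x, e x ∈ U → f (e x) ∈ V := fun x hx => by
    have hne : f (e x) ≠ e x := fun h => (hf.apply_eq_iff _).mp h (mem_range_self x)
    exact hbip.mem_of_mem_adj hx (hf.adj _ hne)
  have hm : ∀ x, ∃ y, e y = f (e x) := fun x => by
    by_contra h
    have h1 := (hf.apply_eq_iff (f (e x))).mpr h
    rw [hf.involutive] at h1
    exact h ⟨x, h1⟩
  choose m hm using hm
  have hmP : ∀ x, s(x, m x) ∈ P.edgeSet := fun x => (hP _ _).mpr (hm x).symm
  rw [finprod_eq_prod_of_fintype, involutionWeight]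
  trans ∏ x : X with e x ∈ U, w s(e x, f (e x))
  · symm
    refine Finset.prod_bij (fun x _ => ⟨s(x, m x), hmP x⟩) (fun _ _ => Finset.mem_univ _) ?_ ?_ ?_
    · intro x hx y hy hxy
      rcases Sym2.eq_iff.mp (congrArg Subtype.val hxy) with h | ⟨h, -⟩
      · exact h.1
      · have hx' : e x ∈ V := by rw [h, hm]; exact hV y (Finset.mem_filter.mp hy).2
        exact absurd hx' (disjoint_left.mp hbip.disjoint (Finset.mem_filter.mp hx).2)
    · rintro ⟨z, hz⟩ -
      induction z using Sym2.ind with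
      | _ x y =>
        have hxy : f (e x) = e y := (hP x y).mp hz
        have hyx : f (e y) = e x := (hP y x).mp (P.symm.symm _ _ hz)
        have hUV' : e x ∈ U ∪ V := hUV ▸ mem_univ _
        rcases hUV' with hx | hx
        · refine ⟨x, by simpa using hx, Subtype.ext ?_⟩
          exact congrArg (fun v => s(x, v)) (he ((hm x).trans hxy))
        · refine ⟨y, ?_, Subtype.ext ?_⟩
          · have hne : f (e x) ≠ e x := fun h => (hf.apply_eq_iff _).mp h (mem_range_self x)
            have hadj := hf.adj _ hne
            rw [hxy] at hadj
            simpa using hbip.symm.mem_of_mem_adj hx hadj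
          · exact (congrArg (fun v => s(y, v)) (he ((hm y).trans hyx))).trans Sym2.eq_swap
    · intro x _
      rw [Sym2.map_mk, hm]
  · refine Finset.prod_bij (fun x _ => e x) ?_ (fun _ _ _ _ h => he h) ?_ (fun _ _ => rfl)
    · intro x hx
      simp only [Finset.mem_filter, Finset.mem_univ, true_and] at hx ⊢
      exact ⟨hx, fun h => (hf.apply_eq_iff _).mp h (mem_range_self x)⟩
    · intro u hu
      simp only [Finset.mem_filter, Finset.mem_univ, true_and] at hu
      obtain ⟨x, rfl⟩ : u ∈ range e := by
        by_contra h
        exact hu.2 ((hf.apply_eq_iff u).mpr h)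
      exact ⟨x, by simpa using hu.1, rfl⟩

/-- A perfect matching is its partner map, extended by the identity to the deleted vertices. The
embedding `e` is general so as to cover both `G` itself and its induced subgraphs, with all
matchings encoded as maps on the same set `W`. -/
theorem matchingSum_eq_sum_involutionWeight {R X : Type*} [CommSemiring R] [Fintype W] [Finite X]
    {G : SimpleGraph W} {U V : Set W} (hbip : G.IsBipartiteWith U V) (hUV : U ∪ V = univ)
    {H : SimpleGraph X} {e : X → W} (he : e.Injective)
    (hadj : ∀ x y, H.Adj x y ↔ G.Adj (e x) (e y)) (w : Sym2 W → R) :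
    matchingSum H (fun z => w (Sym2.map e z)) =
      ∑ᶠ f : {f // IsMatchingInvolution G (range e)ᶜ f}, involutionWeight w U f := by
  classical
  have hpart : ∀ P : {P : H.Subgraph // P.IsPerfectMatching}, ∃ m : X → X,
      ∀ x y, P.1.Adj x y ↔ m x = y := fun P => by
    choose m hm hm' using SimpleGraph.Subgraph.isPerfectMatching_iff.mp P.2
    exact ⟨m, fun x y => ⟨fun h => (hm' x y h).symm, fun h => h ▸ hm x⟩⟩
  choose m hm using hpart
  have hmm : ∀ P x, m P (m P x) = x := fun P x =>
    (hm P _ _).mp (P.1.symm.symm _ _ ((hm P _ _).mpr rfl))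
  let φ : {P : H.Subgraph // P.IsPerfectMatching} → W → W := fun P =>
    Function.extend e (e ∘ m P) id
  have hφe : ∀ P x, φ P (e x) = e (m P x) := fun P x => he.extend_apply _ _ _
  have hφn : ∀ P u, u ∉ range e → φ P u = u := fun P u hu => Function.extend_apply' _ _ _ hu
  have hφadj : ∀ P x y, P.1.Adj x y ↔ φ P (e x) = e y := fun P x y => by
    rw [hm, hφe, he.eq_iff]
  have hφ : ∀ P, IsMatchingInvolution G (range e)ᶜ (φ P) := fun P => by
    refine ⟨fun u => ?_, fun u => ?_, fun u hu => ?_⟩ <;> by_cases h : u ∈ range e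
    · obtain ⟨x, rfl⟩ := h
      rw [hφe, hφe, hmm]
    · rw [hφn P u h, hφn P u h]
    · obtain ⟨x, rfl⟩ := h
      have hne : m P x ≠ x := fun h => P.1.loopless.irrefl x ((hm P x x).mpr h)
      simp [hφe, he.eq_iff, hne]
    · simpa [hφn P u h] using h
    · obtain ⟨x, rfl⟩ := h
      rw [hφe, ← hadj]
      exact P.1.adj_sub ((hm P _ _).mpr rfl)
    · exact absurd (hφn P u h) hu
  refine finsum_eq_of_bijective (fun P => ⟨φ P, hφ P⟩) ⟨fun P Q hPQ => ?_, ?_⟩ fun P =>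
    prod_edgeSet_eq_involutionWeight hbip hUV he P.1 (hφ P) (hφadj P) w
  · have hPQ' : φ P = φ Q := congrArg Subtype.val hPQ
    refine Subtype.ext (SimpleGraph.Subgraph.ext ?_ ?_)
    · rw [P.2.2.verts_eq_univ, Q.2.2.verts_eq_univ]
    · ext x y
      rw [hφadj, hφadj, hPQ']
  · rintro ⟨f, hf⟩
    have hne : ∀ x, f (e x) ≠ e x := fun x h => (hf.apply_eq_iff _).mp h (mem_range_self x)
    let P : H.Subgraph :=
      { verts := univ
        Adj := fun x y => f (e x) = e y
        adj_sub := fun {x y} h => by rw [hadj, ← h]; exact hf.adj _ (hne x)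
        edge_vert := fun _ => mem_univ _
        symm := ⟨fun x y h => by rw [← h, hf.involutive]⟩ }
    have hP : P.IsPerfectMatching := by
      refine SimpleGraph.Subgraph.isPerfectMatching_iff.mpr fun x => ?_
      obtain ⟨y, hy⟩ : f (e x) ∈ range e := by
        by_contra h
        have h1 := (hf.apply_eq_iff (f (e x))).mpr h
        rw [hf.involutive] at h1
        exact h ⟨x, h1⟩
      exact ⟨y, hy.symm, fun z hz => he ((show f (e x) = e z from hz).symm.trans hy.symm)⟩
    refine ⟨⟨P, hP⟩, Subtype.ext (funext fun u => ?_)⟩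
    by_cases hu : u ∈ range e
    · obtain ⟨x, rfl⟩ := hu
      exact (hφe _ _).trans
        (show f (e x) = e (m ⟨P, hP⟩ x) from (hm ⟨P, hP⟩ x _).mpr rfl).symm
    · exact (hφn _ u hu).trans ((hf.apply_eq_iff u).mpr hu).symm

open Classical in
theorem matchingSumDelete_eq_sum {R : Type*} [CommSemiring R] [Fintype W]
    {G : SimpleGraph W} {U V : Set W} (hbip : G.IsBipartiteWith U V) (hUV : U ∪ V = univ)
    (w : Sym2 W → R) (S : Set W) :
    matchingSumDelete G w S = ∑ f with IsMatchingInvolution G S f, involutionWeight w U f := by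
  rw [matchingSumDelete, matchingSum_eq_sum_involutionWeight hbip hUV Subtype.val_injective
    (fun _ _ => Iff.rfl), Subtype.range_coe, compl_compl, finsum_eq_sum_of_fintype]
  exact (Finset.sum_subtype _ (by simp) _).symm

open Classical in
theorem matchingSum_eq_sum {R : Type*} [CommSemiring R] [Fintype W]
    {G : SimpleGraph W} {U V : Set W} (hbip : G.IsBipartiteWith U V) (hUV : U ∪ V = univ)
    (w : Sym2 W → R) :
    matchingSum G w = ∑ f with IsMatchingInvolution G ∅ f, involutionWeight w U f := by
  have h := matchingSum_eq_sum_involutionWeight hbip hUV (H := G) Function.injective_id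
    (fun _ _ => Iff.rfl) w
  rw [Sym2.map_id, range_id, compl_univ] at h
  simp only [id] at h
  rw [h, finsum_eq_sum_of_fintype]
  exact (Finset.sum_subtype _ (by simp) _).symm

open Classical in
/-- Exchange two maps on the joint orbit of `x`. -/
noncomputable def swapOnOrbit (x : W) (p : (W → W) × (W → W)) : (W → W) × (W → W) :=
  ((jointOrbit p.1 p.2 x).piecewise p.2 p.1, (jointOrbit p.1 p.2 x).piecewise p.1 p.2)

/-- The unordered pair of images of each point is unchanged by the exchange. Since the orbit
survives, a second exchange undoes the first. -/
theorem jointOrbit_swapOnOrbit (x : W) (p : (W → W) × (W → W)) :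
    jointOrbit (swapOnOrbit x p).1 (swapOnOrbit x p).2 x = jointOrbit p.1 p.2 x := by
  classical
  have : ∀ u v, (v = (swapOnOrbit x p).1 u ∨ v = (swapOnOrbit x p).2 u) ↔
      (v = p.1 u ∨ v = p.2 u) := fun u v => by
    by_cases hu : u ∈ jointOrbit p.1 p.2 x
    · simp [swapOnOrbit, hu, or_comm]
    · simp [swapOnOrbit, hu]
  unfold jointOrbit
  simp only [this]

theorem swapOnOrbit_involutive (x : W) : (swapOnOrbit x).Involutive := fun p => by
  classical
  have h := jointOrbit_swapOnOrbit x p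
  rw [swapOnOrbit, h]
  ext u <;> by_cases hu : u ∈ jointOrbit p.1 p.2 x <;> simp [swapOnOrbit, hu]

-- Invariance of `T` under both maps prevents any matching edge from leaving `T`, so the two
-- matchings can be cut and recombined there.
open Classical in
theorem IsMatchingInvolution.piecewise {G : SimpleGraph W} {S S' T : Set W} {f g : W → W}
    (hf : IsMatchingInvolution G S f) (hg : IsMatchingInvolution G S' g)
    (hfT : ∀ x, f x ∈ T ↔ x ∈ T) (hgT : ∀ x, g x ∈ T ↔ x ∈ T) :
    IsMatchingInvolution G (S' ∩ T ∪ S \ T) (T.piecewise g f) := by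
  refine ⟨fun x => ?_, fun x => ?_, fun x => ?_⟩ <;> by_cases hx : x ∈ T
  · simp [hx, hgT, hg.involutive x]
  · simp [hx, hfT, hf.involutive x]
  · simp [hx, hg.apply_eq_iff]
  · simp [hx, hf.apply_eq_iff]
  · simpa [hx] using hg.adj x
  · simpa [hx] using hf.adj x

/-- Indexing edges by their ends in `U` makes this local: at each vertex the two factors are kept or
interchanged. -/
theorem involutionWeight_swapOnOrbit {R : Type*} [CommSemiring R] [Fintype W] (w : Sym2 W → R)
    (U : Set W) (x : W) (p : (W → W) × (W → W)) :
    involutionWeight w U (swapOnOrbit x p).1 * involutionWeight w U (swapOnOrbit x p).2 =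
      involutionWeight w U p.1 * involutionWeight w U p.2 := by
  classical
  simp only [involutionWeight, Finset.prod_filter, ← Finset.prod_mul_distrib]
  refine Finset.prod_congr rfl fun u _ => ?_
  by_cases hu : u ∈ jointOrbit p.1 p.2 x
  · simp only [swapOnOrbit, Set.piecewise_eq_of_mem _ _ _ hu, mul_comm]
  · simp only [swapOnOrbit, Set.piecewise_eq_of_notMem _ _ _ hu]

theorem isMatchingInvolution_swapOnOrbit {G : SimpleGraph W} {S S' : Set W} {x : W}
    {p : (W → W) × (W → W)} (hf : IsMatchingInvolution G S p.1)
    (hg : IsMatchingInvolution G S' p.2) :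
    IsMatchingInvolution G (S' ∩ jointOrbit p.1 p.2 x ∪ S \ jointOrbit p.1 p.2 x)
      (swapOnOrbit x p).1 ∧
    IsMatchingInvolution G (S ∩ jointOrbit p.1 p.2 x ∪ S' \ jointOrbit p.1 p.2 x)
      (swapOnOrbit x p).2 :=
  have h₁ := fun _ => apply_left_mem_jointOrbit_iff hf.involutive
  have h₂ := fun _ => apply_right_mem_jointOrbit_iff hg.involutive
  ⟨hf.piecewise hg h₁ h₂, hg.piecewise hf h₂ h₁⟩

end MatchingInvolutions

/-! ### The other end of the path from `a j`. -/

section CyclicOrder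

variable {W : Type*} {k : ℕ} {a b : Fin k → W}

theorem interleave_two_mul (a b : Fin k → W) (i : Fin k) :
    interleave a b ⟨2 * i, by omega⟩ = a i := by
  simp [interleave]

theorem interleave_two_mul_add_one (a b : Fin k → W) (i : Fin k) :
    interleave a b ⟨2 * i + 1, by omega⟩ = b i := by
  have h : (2 * (i : ℕ) + 1) / 2 = i := by omega
  simp [interleave, h]

theorem range_interleave (a b : Fin k → W) : range (interleave a b) = range a ∪ range b := by
  refine Subset.antisymm ?_ (union_subset ?_ ?_)
  · rintro _ ⟨i, rfl⟩
    unfold interleave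
    split_ifs
    exacts [Or.inl (mem_range_self _), Or.inr (mem_range_self _)]
  · rintro _ ⟨i, rfl⟩
    exact ⟨_, interleave_two_mul a b i⟩
  · rintro _ ⟨i, rfl⟩
    exact ⟨_, interleave_two_mul_add_one a b i⟩

variable {G : SimpleGraph W} {D : PlaneDrawing G} {F : Set ℂ} {U V : Set W} {f g : W → W}

open Classical in
/-- A sign distinguishing the two colour classes. -/
noncomputable def colourSign (U : Set W) (x : W) : ℤ := if x ∈ U then 1 else -1

theorem colourSign_eq_neg_of_adj (hbip : G.IsBipartiteWith U V) {x y : W} (h : G.Adj x y) :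
    colourSign U y = -colourSign U x := by
  have hdisj : ∀ {z}, z ∈ V → z ∉ U := fun hz => disjoint_right.mp hbip.disjoint hz
  rcases hbip.mem_of_adj h with ⟨hx, hy⟩ | ⟨hx, hy⟩
  · simp [colourSign, hx, hdisj hy]
  · simp [colourSign, hy, hdisj hx]

/-- Only colours matter here: `f` has no fixed points, so both ends of the path are fixed by `g` and
have opposite signs. -/
theorem exists_jointOrbit_inter_eq [Finite W] (hbip : G.IsBipartiteWith U V)
    (ha : range a ⊆ U) (j : Fin k) (hf : IsMatchingInvolution G ∅ f)
    (hg : IsMatchingInvolution G (range a ∪ range b) g) :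
    ∃ i, jointOrbit f g (a j) ∩ (range a ∪ range b) = {a j, b i} := by
  have hfix : ∀ z, f z ≠ z := fun z hz => (hf.apply_eq_iff z).mp hz
  have haj : g (a j) = a j := (hg.apply_eq_iff _).mpr (Or.inl (mem_range_self j))
  -- The roles of `f` and `g` are exchanged because the starting end must be fixed by the first
  -- involution.
  obtain ⟨y, hy, hyj, hyfix, hall⟩ :=
    exists_other_end hg.involutive hf.involutive haj (hfix _)
  have hgy : g y = y := hyfix.resolve_right (hfix y)
  have hsign := (sign_ends hg.involutive hf.involutive (colourSign U)
    (fun z hz => colourSign_eq_neg_of_adj hbip (hg.adj z hz))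
    (fun z hz => colourSign_eq_neg_of_adj hbip (hf.adj z hz)) (fun z _ => hfix z) haj hy hyj
    hall).1 hgy
  rw [jointOrbit_comm] at hy hall
  have hyab := (hg.apply_eq_iff y).mp hgy
  obtain ⟨i, rfl⟩ : y ∈ range b := by
    refine hyab.resolve_left fun hya => ?_
    simp [colourSign, ha hya, ha (mem_range_self j)] at hsign
  refine ⟨i, Subset.antisymm (fun z hz => hall z hz.1 (Or.inl ((hg.apply_eq_iff z).mpr hz.2))) ?_⟩
  rintro z (rfl | rfl)
  exacts [⟨mem_jointOrbit_self, Or.inl (mem_range_self j)⟩, ⟨hy, hyab⟩]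

/-- This is where planarity enters. If the other end is fixed by `f`, it is `b i`. If it is fixed by
`g`, it has the colour of `a j` and is some `a l`; both are then at even positions of the
interleaved sequence, which noncrossing forbids. -/
theorem jointOrbit_inter_eq [Finite W] (hbip : G.IsBipartiteWith U V) (hF : D.IsFace F)
    (hab : D.InCyclicOrderOn F (interleave a b)) (ha : range a ⊆ U) (hb : range b ⊆ V)
    {i j : Fin k} (hf : IsMatchingInvolution G {a j, b i} f)
    (hg : IsMatchingInvolution G ((range a ∪ range b) \ {a j, b i}) g) :
    jointOrbit f g (a j) ∩ (range a ∪ range b) = {a j, b i} := by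
  have hsub : ({a j, b i} : Set W) ⊆ range a ∪ range b :=
    insert_subset (Or.inl (mem_range_self j)) (singleton_subset_iff.mpr (Or.inr (mem_range_self i)))
  have hfg : ∀ z, f z = z → g z ≠ z := fun z hz hz' =>
    ((hg.apply_eq_iff z).mp hz').2 ((hf.apply_eq_iff z).mp hz)
  have hends : ∀ z, z ∈ range a ∪ range b ↔ f z = z ∨ g z = z := fun z => by
    rw [hf.apply_eq_iff, hg.apply_eq_iff, ← mem_union, union_sdiff_cancel hsub]
  have haj : f (a j) = a j := (hf.apply_eq_iff _).mpr (mem_insert _ _)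
  obtain ⟨y, hy, hyj, hyfix, hall⟩ :=
    exists_other_end hf.involutive hg.involutive haj (hfg _ haj)
  have hsign := sign_ends hf.involutive hg.involutive (colourSign U)
    (fun z hz => colourSign_eq_neg_of_adj hbip (hf.adj z hz))
    (fun z hz => colourSign_eq_neg_of_adj hbip (hg.adj z hz)) hfg haj hy hyj hall
  have hyi : y = b i := by
    rcases hyfix with hfy | hgy
    · exact ((hf.apply_eq_iff y).mp hfy).resolve_left hyj
    · exfalso
      have hs := hsign.2 hgy
      obtain ⟨l, rfl⟩ : y ∈ range a := by
        refine ((hg.apply_eq_iff y).mp hgy).1.resolve_right fun hyb => ?_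
        have hyU : y ∉ U := disjoint_right.mp hbip.disjoint (hb hyb)
        simp [colourSign, hyU, ha (mem_range_self j)] at hs
      have hodd : ∀ p q : Fin k, p < q → a q ∉ jointOrbit f g (a p) := fun p q hpq hmem => by
        have h := odd_add_of_mem_jointOrbit hF hab hf.involutive hg.involutive hf.adj hg.adj hfg
          (by rwa [range_interleave]) (p := ⟨2 * p, by omega⟩) (q := ⟨2 * q, by omega⟩)
          (Fin.mk_lt_mk.mpr (by omega)) (by rwa [interleave_two_mul, interleave_two_mul])
        rw [Nat.odd_iff] at h
        simp only at h
        omega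
      rcases lt_trichotomy l j with h | rfl | h
      · exact hodd l j h (mem_jointOrbit_comm hf.involutive hg.involutive hy)
      · exact hyj rfl
      · exact hodd j l h hy
  subst hyi
  refine Subset.antisymm (fun z hz => hall z hz.1 ((hends z).mp hz.2)) ?_
  rintro z (rfl | rfl)
  exacts [⟨mem_jointOrbit_self, hsub (mem_insert _ _)⟩,
    ⟨hy, hsub (mem_insert_of_mem _ (mem_singleton _))⟩]

end CyclicOrder

/-! ### The weight-preserving bijection. -/

theorem corollary2p3 {R : Type*} [CommSemiring R] {W : Type*} [Finite W]
    (G : SimpleGraph W) (w : Sym2 W → R) (D : PlaneDrawing G)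
    (n : ℕ) (U V : Set W) (hbip : G.IsBipartiteWith U V) (hUV : U ∪ V = Set.univ)
    (hU : U.ncard = n) (hV : V.ncard = n)
    (F : Set ℂ) (hF : D.IsFace F)
    (k : ℕ) (a b : Fin k → W) (hab : D.InCyclicOrderOn F (interleave a b))
    (ha : Set.range a ⊆ U) (hb : Set.range b ⊆ V) (j : Fin k) :
    matchingSum G w * matchingSumDelete G w (Set.range a ∪ Set.range b) =
      ∑ i : Fin k, matchingSumDelete G w {a j, b i} *
        matchingSumDelete G w ((Set.range a ∪ Set.range b) \ {a j, b i}) := by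
  classical
  have := Fintype.ofFinite W
  have hbinj : Function.Injective b := fun i i' h => by
    rw [← interleave_two_mul_add_one a b i, ← interleave_two_mul_add_one a b i'] at h
    have := congrArg Fin.val (hab.injective h)
    simp only at this
    exact Fin.ext (by omega)
  have hsub : ∀ i, ({a j, b i} : Set W) ⊆ range a ∪ range b := fun i =>
    insert_subset (Or.inl (mem_range_self j)) (singleton_subset_iff.mpr (Or.inr (mem_range_self i)))
  rw [matchingSum_eq_sum hbip hUV]
  simp only [matchingSumDelete_eq_sum hbip hUV, Finset.sum_mul_sum, ← Finset.sum_product']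
  -- The right side becomes one sum over a union, disjoint because the fixed points `{a j, b i}` of
  -- the first map determine `i`.
  rw [← Finset.sum_biUnion]
  · refine Finset.sum_nbij' (swapOnOrbit (a j)) (swapOnOrbit (a j)) ?_ ?_
      (fun p _ => swapOnOrbit_involutive _ p) (fun p _ => swapOnOrbit_involutive _ p)
      (fun p _ => (involutionWeight_swapOnOrbit w U _ p).symm)
    · intro p hp
      simp only [Finset.mem_product, Finset.mem_filter, Finset.mem_univ, true_and,
        Finset.mem_biUnion] at hp ⊢
      obtain ⟨i, hi⟩ := exists_jointOrbit_inter_eq hbip ha j hp.1 hp.2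
      obtain ⟨h₁, h₂⟩ := isMatchingInvolution_swapOnOrbit (x := a j) hp.1 hp.2
      refine ⟨i, ?_, ?_⟩
      · rwa [inter_comm, hi, empty_sdiff, union_empty] at h₁
      · rwa [empty_inter, empty_union, ← sdiff_inter_self_eq_sdiff, hi] at h₂
    · intro p hp
      simp only [Finset.mem_product, Finset.mem_filter, Finset.mem_univ, true_and,
        Finset.mem_biUnion] at hp ⊢
      obtain ⟨i, hf, hg⟩ := hp
      have hi := jointOrbit_inter_eq hbip hF hab ha hb hf hg
      obtain ⟨h₁, h₂⟩ := isMatchingInvolution_swapOnOrbit (x := a j) hf hg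
      -- The orbit contains all the vertices deleted by the first map and none of those deleted by
      -- the second, so the exchange restores `∅` and `A ∪ B`.
      have hpair : ({a j, b i} : Set W) ⊆ jointOrbit p.1 p.2 (a j) := hi ▸ inter_subset_left
      have hrest : Disjoint ((range a ∪ range b) \ {a j, b i}) (jointOrbit p.1 p.2 (a j)) :=
        disjoint_left.mpr fun z hz hz' => hz.2 (hi ▸ ⟨hz', hz.1⟩)
      refine ⟨?_, ?_⟩
      · rwa [hrest.inter_eq, sdiff_eq_empty.mpr hpair, union_empty] at h₁
      · rwa [inter_eq_left.mpr hpair, hrest.sdiff_eq_left, union_sdiff_cancel (hsub i)] at h₂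
  · intro i _ i' _ hii
    refine Finset.disjoint_left.mpr fun p hp hp' => hii ?_
    simp only [Finset.mem_product, Finset.mem_filter, Finset.mem_univ, true_and] at hp hp'
    have h : b i ∈ ({a j, b i'} : Set W) := by
      rw [← hp'.1.apply_eq_iff, hp.1.apply_eq_iff]
      exact mem_insert_of_mem _ (mem_singleton _)
    rcases h with h | h
    · exact absurd (ha (mem_range_self j))
        (h ▸ disjoint_right.mp hbip.disjoint (hb (mem_range_self i)))
    · exact hbinj h
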